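/- \textbf{Conventions.} Let $\lambda$ be an infinite cardinal. For an ordinal $\kappa$, a club in $\kappa$ is a closed cofinal subset of $\kappa$, and $S\subseteq\kappa$ is stationary in $\kappa$ if it meets every club in $\kappa$. Limit ordinals are nonzero. For a set $C$ of ordinals, $\mathrm{acc}(C)=\{\beta\in C\mid \beta\neq 0,\ \sup(C\cap\beta)=\beta\}$ and $\mathrm{nacc}(C)=C\setminus\mathrm{acc}(C)$. A \emph{$\square_\lambda$-sequence} is a sequence $\langle C_\alpha\mid\alpha<\lambda^+\rangle$ of sets of ordinals such that for every limit $\alpha<\lambda^+$, $C_\alpha$ is a club in $\alpha$ of order type at most $\lambda$, and $C_\beta=C_\alpha\cap\beta$ for all $\beta\in\mathrm{acc}(C_\alpha)$; $\square_\lambda$ asserts that such a sequence exists. For stationary $S\subseteq\lambda^+$, the principle $\clubsuit\square_\lambda(S)$ asserts that there are a $\square_\lambda$-sequence $\langle C_\alpha\mid\alpha<\lambda^+\rangle$ and a subset $S'\subseteq S$ such that (i) for every club $D$ in $\lambda^+$ and every cofinal $A\subseteq\lambda^+$ there is a limit ordinal $\alpha\in S'$ with $\mathrm{acc}(C_\alpha)\subseteq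 D$ and $\mathrm{nacc}(C_\alpha)\subseteq A$; and (ii) $S'\cap\mathrm{acc}(C_\alpha)=\emptyset$ for all $\alpha<\lambda^+$. A set $S\subseteq\lambda^+$ \emph{reflects stationarily often} if $\{\alpha<\lambda^+\mid \mathrm{cf}(\alpha)>\omega\text{ and }S\cap\alpha\text{ is stationary in }\alpha\}$ is stationary in $\lambda^+$ (such an $S$ is itself stationary). \textbf{Theorem A.} Let $\lambda$ be an uncountable cardinal with $2^\lambda=\lambda^+$. Then the following are equivalent: \begin{enumerate} \item $\square_\lambda$; \item $\clubsuit\square_\lambda(S)$ for every stationary $S\subseteq\{\alpha<\lambda^+\mid \mathrm{cf}(\alpha)\neq\mathrm{cf}(\lambda)\}$; \item $\clubsuit\square_\lambda(S)$ for every $S\subseteq\lambda^+$ that reflects stationarily often. \end{enumerate} -/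

import Mathlib

universe u

namespace OstaszewskiSquare

open Cardinal Ordinal Set Order

/-- `A` is a cofinal subset of the ordinal `κ`. -/
def IsCofinalIn (A : Set Ordinal.{u}) (κ : Ordinal.{u}) : Prop :=
  A ⊆ Iio κ ∧ IsCofinal (Subtype.val ⁻¹' A : Set (Iio κ))

/-- `C` is a closed and cofinal subset of the ordinal `κ`. -/
def IsClubIn (C : Set Ordinal.{u}) (κ : Ordinal.{u}) : Prop :=
  C ⊆ Iio κ ∧ IsClub (Subtype.val ⁻¹' C : Set (Iio κ))

/-- `S` is a subset of the ordinal `κ` that meets every club in `κ`. -/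
def IsStationaryIn (S : Set Ordinal.{u}) (κ : Ordinal.{u}) : Prop :=
  S ⊆ Iio κ ∧ IsStationary (Subtype.val ⁻¹' S : Set (Iio κ))

/-- The accumulation points of `C` that belong to `C`. The supremum of the empty set does not
count, so `0` is never an accumulation point. -/
def acc (C : Set Ordinal.{u}) : Set Ordinal.{u} :=
  {β | β ∈ C ∧ β ≠ 0 ∧ IsLUB (C ∩ Iio β) β}

/-- The elements of `C` that are not accumulation points of `C`. -/
def nacc (C : Set Ordinal.{u}) : Set Ordinal.{u} :=
  C \ acc C

/-- The order type of a set of ordinals. -/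
noncomputable def otp (C : Set Ordinal.{u}) : Ordinal.{u + 1} :=
  Ordinal.type (fun a b : C => a < b)

/-- The successor cardinal `μ⁺`, viewed as an ordinal. -/
noncomputable def succOrd (μ : Cardinal.{u}) : Ordinal.{u} :=
  (succ μ).ord

/-- `⟨C α | α < μ⁺⟩` is a square sequence for `μ`. Only the values at ordinals below `μ⁺` matter,
and nothing is required at `0` and at successor ordinals. -/
def IsSquareSeq (μ : Cardinal.{u}) (C : Ordinal.{u} → Set Ordinal.{u}) : Prop :=
  ∀ α < succOrd μ, IsSuccLimit α →
    IsClubIn (C α) α ∧ otp (C α) ≤ Ordinal.lift.{u + 1} μ.ord ∧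
      ∀ β ∈ acc (C α), C β = C α ∩ Iio β

/-- Jensen's square principle for `μ`. -/
def Square (μ : Cardinal.{u}) : Prop :=
  ∃ C, IsSquareSeq μ C

/-- The principle `♣□_μ(S)`. In the guessing clause the ordinal `α` is a (nonzero) limit ordinal,
so that `C α` is a club in `α`. -/
def ClubSquare (μ : Cardinal.{u}) (S : Set Ordinal.{u}) : Prop :=
  ∃ (C : Ordinal.{u} → Set Ordinal.{u}) (S' : Set Ordinal.{u}),
    IsSquareSeq μ C ∧ S' ⊆ S ∧
    (∀ D A : Set Ordinal.{u}, IsClubIn D (succOrd μ) → IsCofinalIn A (succOrd μ) →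
      ∃ α ∈ S', α < succOrd μ ∧ IsSuccLimit α ∧ acc (C α) ⊆ D ∧ nacc (C α) ⊆ A) ∧
    ∀ α < succOrd μ, S' ∩ acc (C α) = ∅

/-- `S ⊆ κ` reflects stationarily often: stationarily many `α < κ` of uncountable cofinality are
such that `S ∩ α` is stationary in `α`. -/
def ReflectsStationarilyOften (S : Set Ordinal.{u}) (κ : Ordinal.{u}) : Prop :=
  S ⊆ Iio κ ∧
    IsStationaryIn {α | α < κ ∧ ℵ₀ < α.cof ∧ IsStationaryIn (S ∩ Iio α) α} κ

/-- The ordinals below `κ` whose cofinality differs from `θ`. -/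
def cofNe (κ : Ordinal.{u}) (θ : Cardinal.{u}) : Set Ordinal.{u} :=
  {α | α < κ ∧ α.cof ≠ θ}

end OstaszewskiSquare

namespace OstaszewskiSquare

open Cardinal Ordinal Set Order

/-! Only the implications out of `Square` need a combinatorial argument. A witness of `ClubSquare`
contains a square sequence, so the converses only need one set `S` of the required kind.

Fix a square sequence `C`. Since (μ⁺)^μ = 2^μ = μ⁺, a list `x β`, for β < μ⁺, contains all functions
into μ⁺ from an index set of size μ; each β is thus one guess about μ many cofinal sets at once.
Injections `e · γ` of γ into μ number the guesses available at γ.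

Suppose `ClubSquare` fails for `S`. Fix an order type ρ < μ and a bound j < μ, and recurse on ε < μ.
Build from `C` a square sequence which, at the relevant α, has as non-accumulation points only ε-th
coordinates of guesses numbered below j and correct at all earlier stages. Fixing ρ lets the
accumulation points avoid the set of α ∈ `S` with otp (C α) = ρ. As this sequence is no witness,
some cofinal set A(ρ, j, ε) defeats it (`exists_diagonal_family`). Now let all these sets be guessed
at one α ∈ `S` of order type ρ < μ, with numbers below a fixed j. Then for every ε some guess is
right before ε and wrong at ε. These μ many guesses are distinct, yet each is determined by a point
of C α and a number below j, which leaves fewer than μ possibilities (`clubSquare_of_guessedAt`).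

It remains to find α. If cf α ≠ cf μ, then otp (C α) < μ, and the numbers of correct guesses are
bounded on a cofinal set (`guessedAt_of_cof_ne`). If `S` reflects at δ, either cf δ = cf μ and
points of `S` of smaller cofinality below δ serve, or guessing at δ passes by coherence to an
accumulation point of C δ in `S` (`exists_guessedAt_of_reflects`). -/

/-! ### Limit points, clubs and stationary sets. -/

/-- `β` is a nonzero limit of elements of `C` below `β`. -/
def IsLimPt (C : Set Ordinal.{u}) (β : Ordinal.{u}) : Prop :=
  β ≠ 0 ∧ ∀ a < β, ∃ c ∈ C, a < c ∧ c < β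

theorem isLimPt_iff_isLUB {C : Set Ordinal.{u}} {β : Ordinal.{u}} :
    IsLimPt C β ↔ β ≠ 0 ∧ IsLUB (C ∩ Iio β) β := by
  refine and_congr_right fun _ => ⟨fun h => ⟨fun c hc => hc.2.le, fun b hb => ?_⟩, fun h a ha => ?_⟩
  · by_contra! hlt
    obtain ⟨c, hc, hbc, hcβ⟩ := h b hlt
    exact (hb ⟨hc, hcβ⟩).not_gt hbc
  · by_contra! hn
    refine (h.2 (fun c hc => ?_ : a ∈ upperBounds (C ∩ Iio β))).not_gt ha
    by_contra! hac
    exact (hn c hc.1 hac).not_gt hc.2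

theorem mem_acc {C : Set Ordinal.{u}} {β : Ordinal.{u}} : β ∈ acc C ↔ β ∈ C ∧ IsLimPt C β := by
  rw [isLimPt_iff_isLUB]; rfl

theorem IsLimPt.mono {C D : Set Ordinal.{u}} {β : Ordinal.{u}} (h : IsLimPt C β) (hCD : C ⊆ D) :
    IsLimPt D β :=
  ⟨h.1, fun a ha => let ⟨c, hc, h'⟩ := h.2 a ha; ⟨c, hCD hc, h'⟩⟩

theorem IsLimPt.isSuccLimit {C : Set Ordinal.{u}} {β : Ordinal.{u}} (h : IsLimPt C β) :
    IsSuccLimit β := by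
  rw [Ordinal.isSuccLimit_iff, isSuccPrelimit_iff_succ_lt]
  refine ⟨h.1, fun a ha => ?_⟩
  obtain ⟨c, -, hac, hcβ⟩ := h.2 a ha
  exact (succ_le_of_lt hac).trans_lt hcβ

theorem isLimPt_inter_Iio {C : Set Ordinal.{u}} {β δ : Ordinal.{u}} (h : β ≤ δ) :
    IsLimPt (C ∩ Iio δ) β ↔ IsLimPt C β :=
  ⟨fun H => H.mono inter_subset_left, fun H => ⟨H.1, fun a ha =>
    let ⟨c, hc, h1, h2⟩ := H.2 a ha; ⟨c, ⟨hc, h2.trans_le h⟩, h1, h2⟩⟩⟩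

theorem acc_inter_Iio (C : Set Ordinal.{u}) (δ : Ordinal.{u}) :
    acc (C ∩ Iio δ) = acc C ∩ Iio δ := by
  ext β
  simp only [mem_acc, mem_inter_iff, mem_Iio]
  constructor
  · rintro ⟨⟨h1, h2⟩, h3⟩
    exact ⟨⟨h1, (isLimPt_inter_Iio h2.le).1 h3⟩, h2⟩
  · rintro ⟨⟨h1, h3⟩, h2⟩
    exact ⟨⟨h1, h2⟩, (isLimPt_inter_Iio h2.le).2 h3⟩

theorem isCofinalIn_iff {A : Set Ordinal.{u}} {κ : Ordinal.{u}} :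
    IsCofinalIn A κ ↔ A ⊆ Iio κ ∧ ∀ a < κ, ∃ b ∈ A, a ≤ b := by
  refine and_congr_right fun hA => ⟨fun h a ha => ?_, fun h a => ?_⟩
  · obtain ⟨b, hb, hab⟩ := h ⟨a, ha⟩
    exact ⟨b, hb, hab⟩
  · obtain ⟨b, hb, hab⟩ := h a a.2
    exact ⟨⟨b, hA hb⟩, hb, hab⟩

theorem isClubIn_iff {C : Set Ordinal.{u}} {δ : Ordinal.{u}} :
    IsClubIn C δ ↔ C ⊆ Iio δ ∧ (∀ a < δ, ∃ c ∈ C, a ≤ c) ∧ ∀ β < δ, IsLimPt C β → β ∈ C := by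
  constructor
  · rintro ⟨hC, hcl, hcof⟩
    refine ⟨hC, (isCofinalIn_iff.1 ⟨hC, hcof⟩).2, fun β hβ hlim => ?_⟩
    refine @hcl {c | c.1 ∈ C ∧ c.1 < β} (fun c hc => hc.1) ?_ (.of_linearOrder _) ⟨β, hβ⟩ ?_
    · obtain ⟨c, hc, -, hcβ⟩ := hlim.2 0 (pos_iff_ne_zero.2 hlim.1)
      exact ⟨⟨c, hC hc⟩, hc, hcβ⟩
    · refine ⟨fun c hc => hc.2.le, fun b hb => ?_⟩
      by_contra! hlt
      obtain ⟨c, hc, hbc, hcβ⟩ := hlim.2 b hlt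
      exact (show (⟨c, hC hc⟩ : Iio δ) ≤ b from hb ⟨hc, hcβ⟩).not_gt hbc
  · rintro ⟨hC, hcof, hcl⟩
    refine ⟨hC, ⟨fun d hd hd0 _ a ha => ?_, (isCofinalIn_iff.2 ⟨hC, hcof⟩).2⟩⟩
    by_contra hac
    refine hac (hcl a a.2 ⟨?_, fun b hb => ?_⟩)
    · intro h0
      obtain ⟨c, hc⟩ := hd0
      have : c = a := le_antisymm (ha.1 hc) (show a.1 ≤ c.1 by rw [h0]; exact zero_le)
      exact hac (this ▸ hd hc)
    · by_contra! hn
      refine (ha.2 (fun c hc => ?_ : (⟨b, hb.trans a.2⟩ : Iio δ) ∈ upperBounds d)).not_gt hb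
      by_contra! hbc
      have h1 := hn c (hd hc) hbc
      exact hac (le_antisymm (ha.1 hc) h1 ▸ hd hc)

theorem IsClubIn.exists_gt {C : Set Ordinal.{u}} {δ a : Ordinal.{u}} (hC : IsClubIn C δ)
    (hδ : IsSuccLimit δ) (ha : a < δ) : ∃ c ∈ C, a < c := by
  obtain ⟨c, hc, hac⟩ := (isClubIn_iff.1 hC).2.1 _ (hδ.succ_lt ha)
  exact ⟨c, hc, (lt_succ a).trans_le hac⟩

theorem cof_Iio_eq (δ : Ordinal.{u}) : Order.cof (Iio δ) = Cardinal.lift.{u + 1} δ.cof := by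
  rw [Ordinal.cof_Iio, Ordinal.lift_cof]

theorem IsClubIn.inter {C D : Set Ordinal.{u}} {δ : Ordinal.{u}} (hδ : ℵ₀ < δ.cof)
    (hC : IsClubIn C δ) (hD : IsClubIn D δ) : IsClubIn (C ∩ D) δ := by
  refine ⟨inter_subset_left.trans hC.1, hC.2.inter ?_ hD.2⟩
  rw [cof_Iio_eq, ← Cardinal.lift_aleph0.{u + 1, u}, Ne, Cardinal.lift_inj]
  exact hδ.ne'

theorem IsStationaryIn.exists_mem {S C : Set Ordinal.{u}} {δ : Ordinal.{u}}
    (hS : IsStationaryIn S δ) (hC : IsClubIn C δ) : ∃ α ∈ S, α ∈ C := by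
  obtain ⟨α, h1, h2⟩ := hS.2 hC.2
  exact ⟨α, h1, h2⟩

theorem isStationaryIn_of_forall {S : Set Ordinal.{u}} {δ : Ordinal.{u}} (hS : S ⊆ Iio δ)
    (h : ∀ D, IsClubIn D δ → ∃ α ∈ S, α ∈ D) : IsStationaryIn S δ := by
  refine ⟨hS, fun t ht => ?_⟩
  have ht' : Subtype.val ⁻¹' (Subtype.val '' t) = t := preimage_image_eq _ Subtype.val_injective
  obtain ⟨α, h1, β, h2, rfl⟩ := h (Subtype.val '' t)
    ⟨by rintro _ ⟨b, -, rfl⟩; exact b.2, by rwa [ht']⟩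
  exact ⟨β, h1, h2⟩

/-- The points closed under a relation that is antitone in its first argument form a club. -/
theorem isClubIn_closurePoints {δ : Ordinal.{u}} (hδ : ℵ₀ < δ.cof)
    {P : Ordinal.{u} → Ordinal.{u} → Prop} (hanti : ∀ a a' b, a' ≤ a → P a b → P a' b)
    (hlt : ∀ a b, P a b → a < b) (hex : ∀ a < δ, ∃ b < δ, P a b) :
    IsClubIn {α | α < δ ∧ α ≠ 0 ∧ ∀ a < α, ∃ b < α, P a b} δ := by
  refine isClubIn_iff.2 ⟨fun α h => h.1, fun a ha => ?_,
    fun β hβ hlim => ⟨hβ, hlim.1, fun a ha => ?_⟩⟩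
  -- The supremum of the ω iterates of `g` is a closure point; it stays below δ because cf δ is
  -- uncountable, and antitonicity passes the relation from the iterates to the ordinals below them.
  · choose! g hgδ hg using hex
    have hit : ∀ n : ℕ, g^[n] a < δ := by
      intro n
      induction n with
      | zero => exact ha
      | succ n ih => rw [Function.iterate_succ_apply']; exact hgδ _ ih
    have hstep : ∀ n : ℕ, P (g^[n] a) (g^[n + 1] a) := by
      intro n
      rw [Function.iterate_succ_apply']
      exact hg _ (hit n)
    have hle : ∀ n : ℕ, g^[n] a ≤ ⨆ n : ℕ, g^[n] a :=
      fun n => Ordinal.le_iSup (fun n : ℕ => g^[n] a) n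
    have hlt' : ∀ n : ℕ, g^[n] a < ⨆ n : ℕ, g^[n] a :=
      fun n => (hlt _ _ (hstep n)).trans_le (hle (n + 1))
    refine ⟨⨆ n : ℕ, g^[n] a, ⟨?_, ?_, fun b hb => ?_⟩, hle 0⟩
    · refine lift_iSup_lt_of_lt_cof ?_ hit
      simpa using hδ
    · exact (zero_le.trans_lt (hlt' 0)).ne'
    · obtain ⟨n, hn⟩ := Ordinal.lt_iSup_iff.1 hb
      exact ⟨_, hlt' (n + 1), hanti _ _ _ hn.le (hstep n)⟩
  · obtain ⟨c, ⟨-, -, hc⟩, hac, hcβ⟩ := hlim.2 a ha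
    obtain ⟨b, hb, h⟩ := hc a hac
    exact ⟨b, hb.trans hcβ, h⟩

theorem isSuccLimit_of_closurePoint {α : Ordinal.{u}} (h0 : α ≠ 0)
    (h : ∀ a < α, ∃ b < α, a < b) : IsSuccLimit α := by
  rw [Ordinal.isSuccLimit_iff, isSuccPrelimit_iff_succ_lt]
  refine ⟨h0, fun a ha => ?_⟩
  obtain ⟨b, hb, hab⟩ := h a ha
  exact (succ_le_of_lt hab).trans_lt hb

/-! ### Order types and cofinalities. -/

/-- The chosen `c` lies before the next element of `T`, so the choice is strictly increasing. This
bounds the order type of a modified club that need not be a subset of `C`. -/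
theorem otp_le_of_interleave {T C : Set Ordinal.{u}}
    (h : ∀ t ∈ T, ∃ c ∈ C, t ≤ c ∧ ∀ t' ∈ T, t < t' → c < t') : otp T ≤ otp C := by
  choose g hgC hle hlt using fun t : T => h t t.2
  refine Ordinal.type_le_iff'.2 ⟨RelEmbedding.ofMonotone (fun t => ⟨g t, hgC t⟩) fun a b hab => ?_⟩
  exact (hlt a b b.2 hab).trans_le (hle b)

theorem otp_mono {T C : Set Ordinal.{u}} (h : T ⊆ C) : otp T ≤ otp C :=
  otp_le_of_interleave fun t ht => ⟨t, h ht, le_rfl, fun _ _ h => h⟩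

theorem otp_inter_Iio_lt {C : Set Ordinal.{u}} {β : Ordinal.{u}} (hβ : β ∈ C) :
    otp (C ∩ Iio β) < otp C := by
  have h1 : otp (C ∩ Iio β) ≤ typein (fun a b : C => a < b) ⟨β, hβ⟩ := by
    refine Ordinal.type_le_iff'.2
      ⟨RelEmbedding.ofMonotone (fun t => ⟨⟨t.1, t.2.1⟩, t.2.2⟩) fun a b hab => ?_⟩
    exact hab
  exact h1.trans_lt (typein_lt_type _ _)

theorem mk_lt_of_otp_lt {C : Set Ordinal.{u}} {μ : Cardinal.{u}}
    (h : otp C < Ordinal.lift.{u + 1} μ.ord) : #C < Cardinal.lift.{u + 1} μ := by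
  rw [lift_ord, lt_ord] at h
  simpa [otp] using h

/-- A club in δ has the cofinality of δ, so order type exactly μ would force cf δ = cf μ. -/
theorem otp_lt_of_cof_ne {C : Set Ordinal.{u}} {δ : Ordinal.{u}} {μ : Cardinal.{u}}
    (hC : IsClubIn C δ) (hle : otp C ≤ Ordinal.lift.{u + 1} μ.ord) (hne : δ.cof ≠ μ.ord.cof) :
    otp C < Ordinal.lift.{u + 1} μ.ord := by
  refine hle.lt_of_ne fun heq => hne ?_
  have h1 : (otp C).cof = Order.cof C := Ordinal.cof_type C
  have h2 : Order.cof C = Order.cof (Iio δ) := by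
    refine cof_congr_of_strictMono (f := fun c : C => (⟨c.1, hC.1 c.2⟩ : Iio δ)) (fun a b h => h) ?_
    intro a
    obtain ⟨b, hb, hab⟩ := hC.2.isCofinal a
    exact ⟨b, ⟨⟨b, hb⟩, rfl⟩, hab⟩
  rw [heq, h2, cof_Iio_eq, ← lift_cof, Cardinal.lift_inj] at h1
  exact h1.symm

/-- A function between linear orders of different cofinality is bounded on a cofinal set. -/
theorem exists_isCofinal_setOf_lt {X Y : Type u} [LinearOrder X] [LinearOrder Y] [NoMaxOrder Y]
    (f : X → Y) (h : Order.cof X ≠ Order.cof Y) : ∃ y, IsCofinal {x | f x < y} := by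
  rcases h.lt_or_gt with h | h
  · obtain ⟨s, hs, hcard⟩ := exists_cof_eq X
    have hn : ¬ IsCofinal (f '' s) := fun hc =>
      ((cof_le hc).trans (mk_image_le.trans hcard.le)).not_gt h
    obtain ⟨y, hy⟩ := not_isCofinal_iff.1 hn
    exact ⟨y, hs.mono fun x hx => hy _ (mem_image_of_mem f hx)⟩
  · obtain ⟨t, ht, hcard⟩ := exists_cof_eq Y
    obtain ⟨y, hy⟩ := isCofinal_of_isCofinal_iUnion (s := fun y : t => {x | f x ≤ y})
      (fun x => by
        obtain ⟨y, hy, hxy⟩ := ht (f x)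
        exact ⟨x, mem_iUnion.2 ⟨⟨y, hy⟩, hxy⟩, le_rfl⟩) (by rwa [hcard])
    obtain ⟨z, hz⟩ := exists_gt y.1
    exact ⟨z, hy.mono fun x hx => lt_of_le_of_lt hx hz⟩

/-- Take a cofinal set of order type cf δ. At a limit point α < δ of it, its part below α is cofinal
in α and is bounded by one of its elements, hence has size less than cf δ. -/
theorem exists_isClubIn_cof_lt {δ : Ordinal.{u}} (hδ : ℵ₀ < δ.cof) :
    ∃ D, IsClubIn D δ ∧ ∀ α ∈ D, α.cof < δ.cof := by
  obtain ⟨s, hs, hs'⟩ := exists_ord_cof_eq (Iio δ)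
  have hcard : #s = Order.cof (Iio δ) := by simpa using congrArg Ordinal.card hs'
  have hlim : IsSuccLimit δ := one_lt_cof_iff.1 (one_lt_aleph0.trans hδ)
  refine ⟨_, isClubIn_closurePoints hδ (P := fun a b => b ∈ Subtype.val '' s ∧ a < b)
    (fun a a' b h h' => ⟨h'.1, h.trans_lt h'.2⟩) (fun a b h => h.2) fun a ha => ?_, ?_⟩
  · obtain ⟨b, hb, hab⟩ := hs ⟨succ a, hlim.succ_lt ha⟩
    exact ⟨b, b.2, ⟨b, hb, rfl⟩, (lt_succ a).trans_le hab⟩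
  · rintro α ⟨hαδ, -, hα⟩
    obtain ⟨t, ht, hαt⟩ := hs ⟨α, hαδ⟩
    rw [← Cardinal.lift_lt.{u, u + 1}, ← cof_Iio_eq, ← cof_Iio_eq, ← hcard]
    have hcof : IsCofinal {x : Iio α | x.1 ∈ Subtype.val '' s} := fun a => by
      obtain ⟨b, hb, hbs, hab⟩ := hα a a.2
      exact ⟨⟨b, hb⟩, hbs, hab.le⟩
    refine (cof_le hcof).trans_lt (lt_of_le_of_lt ?_
      (mk_Iio_lt (⟨t, ht⟩ : s) (by rw [hcard, hs'])))
    have hmem : ∀ x : {x : Iio α | x.1 ∈ Subtype.val '' s},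
        ∃ h : x.1.1 < δ, (⟨x.1.1, h⟩ : Iio δ) ∈ s := by
      rintro ⟨⟨z, hx⟩, y, hy, hyz⟩
      obtain rfl : y.1 = z := hyz
      exact ⟨y.2, hy⟩
    refine mk_le_of_injective (f := fun x => ⟨⟨⟨x.1.1, (hmem x).1⟩, (hmem x).2⟩, ?_⟩) ?_
    · exact show x.1.1 < t.1 from lt_of_lt_of_le x.1.2 hαt
    · intro x y hxy
      apply Subtype.ext
      apply Subtype.ext
      exact congrArg (fun z => z.1.1.1) hxy

theorem cof_succOrd {μ : Cardinal.{u}} (hμ : ℵ₀ ≤ μ) : (succOrd μ).cof = succ μ :=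
  (isRegular_succ hμ).cof_ord

theorem isSuccLimit_succOrd {μ : Cardinal.{u}} (hμ : ℵ₀ ≤ μ) : IsSuccLimit (succOrd μ) :=
  isSuccLimit_ord (hμ.trans (le_succ μ))

/-- The increasing enumeration of a club is continuous, so its value at index θ has cofinality θ. -/
theorem IsClubIn.exists_cof_eq {μ θ : Cardinal.{u}} {D : Set Ordinal.{u}}
    (hD : IsClubIn D (succOrd μ)) (hθ : θ.IsRegular) (hθμ : θ ≤ μ) :
    ∃ α ∈ D, α.cof = θ := by
  have hμ : ℵ₀ ≤ μ := hθ.aleph0_le.trans hθμ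
  set κ := succOrd μ with hκ
  -- Adding all ordinals from κ on makes the set unbounded, as `enumOrd` requires, without changing
  -- the enumeration below κ.
  set s : Set Ordinal.{u} := D ∪ Ici κ with hs
  obtain ⟨hDκ, hcof, hcl⟩ := isClubIn_iff.1 hD
  have hbdd : ¬ BddAbove s := fun ⟨b, hb⟩ =>
    (hb (Or.inr (show κ ≤ max κ (succ b) from le_max_left _ _))).not_gt
      ((lt_succ b).trans_le (le_max_right _ _))
  have hnormal : IsNormal (enumOrd s) := by
    refine isNormal_enumOrd (fun t hts ht0 htb => ?_) hbdd
    by_contra hn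
    have hlt : sSup t < κ := not_le.1 fun h => hn (Or.inr h)
    refine hn (Or.inl (hcl _ hlt ⟨fun h0 => ?_, fun a ha => ?_⟩))
    · obtain ⟨c, hc⟩ := ht0
      have : c = sSup t := le_antisymm (le_csSup htb hc) (by rw [h0]; exact zero_le)
      exact hn (this ▸ hts hc)
    · obtain ⟨c, hc, hac⟩ := exists_lt_of_lt_csSup ht0 ha
      have hcs : c < sSup t := (le_csSup htb hc).lt_of_ne fun h => hn (h ▸ hts hc)
      exact ⟨c, (hts hc).resolve_right fun h => (hcs.trans hlt).not_ge h, hac, hcs⟩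
  -- Otherwise `D` would have at most θ ≤ μ elements and be bounded in the regular cardinal μ⁺.
  have hlt : enumOrd s θ.ord < κ := by
    by_contra! hge
    have hsub : D ⊆ enumOrd s '' Iio θ.ord := fun d hd => by
      obtain ⟨i, rfl⟩ := enumOrd_surjective hbdd (show d ∈ s from Or.inl hd)
      exact ⟨i, (enumOrd_lt_enumOrd hbdd).1 ((hDκ hd).trans_le hge), rfl⟩
    have hcard : #D < (Ordinal.lift.{u + 1} κ).cof := by
      rw [← lift_cof, cof_succOrd hμ]
      refine (mk_le_mk_of_subset hsub).trans_lt (mk_image_le.trans_lt ?_)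
      rw [Cardinal.mk_Iio_ordinal, card_ord, Cardinal.lift_lt]
      exact lt_succ_of_le hθμ
    have hsup : sSup D < κ := sSup_lt_of_lt_cof hcard fun d hd => hDκ hd
    obtain ⟨c, hc, hlt⟩ := hD.exists_gt (isSuccLimit_succOrd hμ) hsup
    exact (le_csSup ⟨κ, fun d hd => (hDκ hd).le⟩ hc).not_gt hlt
  refine ⟨enumOrd s θ.ord, (enumOrd_mem hbdd _).resolve_right fun h => hlt.not_ge h, ?_⟩
  rw [cof_map_of_isNormal hnormal (isSuccLimit_ord hθ.aleph0_le), hθ.cof_ord]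

/-! ### Trimming a single club. -/

/-- The elements `γ` of `C` that are related to the supremum of the previously kept elements. -/
def kept (R : Ordinal.{u} → Ordinal.{u} → Prop) (C : Set Ordinal.{u}) (γ : Ordinal.{u}) : Prop :=
  γ ∈ C ∧ R (sSup {γ' | ∃ _ : γ' < γ, kept R C γ'}) γ
termination_by γ

/-- The set of kept elements of `C`. -/
def keptSet (R : Ordinal.{u} → Ordinal.{u} → Prop) (C : Set Ordinal.{u}) : Set Ordinal.{u} :=
  {γ | kept R C γ}

theorem mem_keptSet {R : Ordinal.{u} → Ordinal.{u} → Prop} {C : Set Ordinal.{u}} {γ : Ordinal.{u}} :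
    γ ∈ keptSet R C ↔ γ ∈ C ∧ R (sSup (keptSet R C ∩ Iio γ)) γ := by
  have : {γ' | ∃ _ : γ' < γ, kept R C γ'} = keptSet R C ∩ Iio γ := by
    ext γ'
    simp [keptSet, and_comm]
  rw [← this, keptSet, mem_ofPred_eq, kept]

/-- Whether γ is kept depends only on the part of `C` up to γ; coherence of the trimmed clubs rests
on this. -/
theorem keptSet_inter_Iio (R : Ordinal.{u} → Ordinal.{u} → Prop) (C : Set Ordinal.{u})
    (β : Ordinal.{u}) : keptSet R (C ∩ Iio β) = keptSet R C ∩ Iio β := by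
  ext γ
  induction γ using WellFoundedLT.induction with
  | ind γ ih =>
    by_cases hγ : γ < β
    · have : keptSet R (C ∩ Iio β) ∩ Iio γ = keptSet R C ∩ Iio γ := by
        ext γ'
        simp only [mem_inter_iff, mem_Iio]
        constructor
        · rintro ⟨h1, h2⟩
          exact ⟨((ih γ' h2).1 h1).1, h2⟩
        · rintro ⟨h1, h2⟩
          exact ⟨(ih γ' h2).2 ⟨h1, h2.trans hγ⟩, h2⟩
      rw [mem_keptSet, this, mem_inter_iff, mem_inter_iff, mem_keptSet, mem_Iio]
      tauto
    · exact ⟨fun h => absurd (mem_keptSet.1 h).1.2 hγ, fun h => absurd h.2 hγ⟩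

/-- The replacement of a kept element `γ`. -/
noncomputable def substPoint (R : Ordinal.{u} → Ordinal.{u} → Prop)
    (p : Ordinal.{u} → Ordinal.{u} → Ordinal.{u}) (C : Set Ordinal.{u}) (γ : Ordinal.{u}) :
    Ordinal.{u} :=
  p (sSup (keptSet R C ∩ Iio γ)) γ

/-- Replace the kept elements of `C` according to `p` and close off below `δ`; when only boundedly
many elements are kept, return a final segment of `C`. -/
def trim (R : Ordinal.{u} → Ordinal.{u} → Prop) (p : Ordinal.{u} → Ordinal.{u} → Ordinal.{u})
    (C : Set Ordinal.{u}) (δ : Ordinal.{u}) : Set Ordinal.{u} :=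
  {t | (∀ a < δ, ∃ γ ∈ keptSet R C, a < γ) ∧
      (t ∈ substPoint R p C '' keptSet R C ∨ t < δ ∧ IsLimPt (keptSet R C) t)} ∪
    {t | ¬ (∀ a < δ, ∃ γ ∈ keptSet R C, a < γ) ∧ t ∈ C ∧ sSup (keptSet R C) < t}

section trim

variable {R : Ordinal.{u} → Ordinal.{u} → Prop} {p : Ordinal.{u} → Ordinal.{u} → Ordinal.{u}}
  {C : Set Ordinal.{u}} {δ : Ordinal.{u}}

theorem keptSet_subset : keptSet R C ⊆ C := fun _ h => (mem_keptSet.1 h).1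

theorem trim_of_cofinal (h : ∀ a < δ, ∃ γ ∈ keptSet R C, a < γ) :
    trim R p C δ = substPoint R p C '' keptSet R C ∪ {t | t < δ ∧ IsLimPt (keptSet R C) t} := by
  ext t
  simp only [trim, mem_union, mem_ofPred_eq]
  tauto

theorem trim_of_not_cofinal (h : ¬ ∀ a < δ, ∃ γ ∈ keptSet R C, a < γ) :
    trim R p C δ = {t | t ∈ C ∧ sSup (keptSet R C) < t} := by
  ext t
  simp only [trim, mem_union, mem_ofPred_eq]
  tauto

theorem le_sSup_keptSet {γ γ' : Ordinal.{u}} (h' : γ' ∈ keptSet R C) (hlt : γ' < γ) :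
    γ' ≤ sSup (keptSet R C ∩ Iio γ) :=
  le_csSup ⟨γ, fun _ h => h.2.le⟩ ⟨h', hlt⟩

theorem subst_lt (hp : ∀ s γ, R s γ → s < p s γ ∧ p s γ < γ) {γ : Ordinal.{u}}
    (h : γ ∈ keptSet R C) : substPoint R p C γ < γ :=
  (hp _ _ (mem_keptSet.1 h).2).2

theorem lt_subst_of_lt (hp : ∀ s γ, R s γ → s < p s γ ∧ p s γ < γ) {γ γ' : Ordinal.{u}}
    (h : γ ∈ keptSet R C) (h' : γ' ∈ keptSet R C) (hlt : γ' < γ) : γ' < substPoint R p C γ :=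
  (le_sSup_keptSet h' hlt).trans_lt (hp _ _ (mem_keptSet.1 h).2).1

theorem lt_subst_of_isLimPt (hp : ∀ s γ, R s γ → s < p s γ ∧ p s γ < γ) {γ β : Ordinal.{u}}
    (h : γ ∈ keptSet R C) (hβ : IsLimPt (keptSet R C) β) (hle : β ≤ γ) :
    β < substPoint R p C γ := by
  refine lt_of_le_of_lt ?_ (hp _ _ (mem_keptSet.1 h).2).1
  refine le_of_forall_lt fun a ha => ?_
  obtain ⟨c, hc, hac, hcβ⟩ := hβ.2 a ha
  exact hac.trans_le (le_sSup_keptSet hc (hcβ.trans_le hle))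

theorem lt_of_subst_lt (hp : ∀ s γ, R s γ → s < p s γ ∧ p s γ < γ) {γ t : Ordinal.{u}}
    (hcof : ∀ a < δ, ∃ γ ∈ keptSet R C, a < γ)
    (h : γ ∈ keptSet R C) (ht : t ∈ trim R p C δ) (hlt : substPoint R p C γ < t) : γ < t := by
  rw [trim_of_cofinal hcof] at ht
  rcases ht with ⟨γ', h', rfl⟩ | ⟨-, hlim⟩
  · refine lt_subst_of_lt hp h' h ?_
    by_contra! hle
    rcases hle.eq_or_lt with rfl | hlt'
    · exact hlt.false
    · exact ((subst_lt hp h').trans (lt_subst_of_lt hp h h' hlt')).not_gt hlt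
  · by_contra! hle
    exact (lt_subst_of_isLimPt hp h hlim hle).not_gt hlt

/-- Each replacement lies strictly between the supremum of the earlier kept elements and the element
it replaces, so the two sets interleave. -/
theorem isLimPt_trim_iff (hp : ∀ s γ, R s γ → s < p s γ ∧ p s γ < γ)
    (hcof : ∀ a < δ, ∃ γ ∈ keptSet R C, a < γ) {β : Ordinal.{u}} :
    IsLimPt (trim R p C δ) β ↔ IsLimPt (keptSet R C) β := by
  constructor
  · refine fun h => ⟨h.1, fun a ha => ?_⟩
    obtain ⟨c, hc, hac, hcβ⟩ := h.2 a ha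
    obtain ⟨c', hc', hcc', hc'β⟩ := h.2 c hcβ
    have hc2 := hc
    rw [trim_of_cofinal hcof] at hc2
    rcases hc2 with ⟨γ, hγ, rfl⟩ | ⟨-, hlim⟩
    · exact ⟨γ, hγ, hac.trans (subst_lt hp hγ), (lt_of_subst_lt hp hcof hγ hc' hcc').trans hc'β⟩
    · obtain ⟨k, hk, hak, hkc⟩ := hlim.2 a hac
      exact ⟨k, hk, hak, hkc.trans hcβ⟩
  · refine fun h => ⟨h.1, fun a ha => ?_⟩
    obtain ⟨k, hk, hak, hkβ⟩ := h.2 a ha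
    obtain ⟨k', hk', hkk', hk'β⟩ := h.2 k hkβ
    refine ⟨substPoint R p C k', ?_, hak.trans (lt_subst_of_lt hp hk' hk hkk'),
      (subst_lt hp hk').trans hk'β⟩
    rw [trim_of_cofinal hcof]
    exact Or.inl ⟨k', hk', rfl⟩

theorem isClubIn_trim (hp : ∀ s γ, R s γ → s < p s γ ∧ p s γ < γ) (hC : IsClubIn C δ)
    (hδ : IsSuccLimit δ) : IsClubIn (trim R p C δ) δ := by
  obtain ⟨hCδ, -, hcl⟩ := isClubIn_iff.1 hC
  by_cases hcof : ∀ a < δ, ∃ γ ∈ keptSet R C, a < γ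
  · refine isClubIn_iff.2 ⟨?_, fun a ha => ?_, fun β hβ hlim => ?_⟩
    · rw [trim_of_cofinal hcof]
      rintro _ (⟨γ, hγ, rfl⟩ | h)
      · exact (subst_lt hp hγ).trans (hCδ (keptSet_subset hγ))
      · exact h.1
    · obtain ⟨k, hk, hak⟩ := hcof a ha
      obtain ⟨k', hk', hkk'⟩ := hcof k (hCδ (keptSet_subset hk))
      refine ⟨substPoint R p C k', ?_, hak.le.trans (lt_subst_of_lt hp hk' hk hkk').le⟩
      rw [trim_of_cofinal hcof]
      exact Or.inl ⟨k', hk', rfl⟩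
    · rw [isLimPt_trim_iff hp hcof] at hlim
      rw [trim_of_cofinal hcof]
      exact Or.inr ⟨hβ, hlim⟩
  · rw [trim_of_not_cofinal hcof]
    push Not at hcof
    obtain ⟨b, hb, hbK⟩ := hcof
    have hsup : sSup (keptSet R C) ≤ b := csSup_le' fun k hk => hbK k hk
    refine isClubIn_iff.2 ⟨fun t ht => hCδ ht.1, fun a ha => ?_, fun β hβ hlim => ?_⟩
    · obtain ⟨c, hc, hlt⟩ := hC.exists_gt hδ (max_lt ha hb)
      exact ⟨c, ⟨hc, hsup.trans_lt ((le_max_right a b).trans_lt hlt)⟩,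
        (le_max_left a b).trans hlt.le⟩
    · obtain ⟨c, hc, -, hcβ⟩ := hlim.2 0 (pos_iff_ne_zero.2 hlim.1)
      exact ⟨hcl β hβ (hlim.mono fun t ht => ht.1), hc.2.trans hcβ⟩

theorem otp_trim_le (hp : ∀ s γ, R s γ → s < p s γ ∧ p s γ < γ) (hC : IsClubIn C δ) :
    otp (trim R p C δ) ≤ otp C := by
  by_cases hcof : ∀ a < δ, ∃ γ ∈ keptSet R C, a < γ
  · refine otp_le_of_interleave fun t ht => ?_
    have ht2 := ht
    rw [trim_of_cofinal hcof] at ht2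
    rcases ht2 with ⟨γ, hγ, rfl⟩ | ⟨htδ, hlim⟩
    · exact ⟨γ, keptSet_subset hγ, (subst_lt hp hγ).le,
        fun t' ht' hlt => lt_of_subst_lt hp hcof hγ ht' hlt⟩
    · exact ⟨t, (isClubIn_iff.1 hC).2.2 t htδ (hlim.mono keptSet_subset), le_rfl,
        fun _ _ h => h⟩
  · rw [trim_of_not_cofinal hcof]
    exact otp_mono fun t ht => ht.1

theorem acc_trim_subset (hp : ∀ s γ, R s γ → s < p s γ ∧ p s γ < γ) (hC : IsClubIn C δ)
    (hδ : IsSuccLimit δ) : acc (trim R p C δ) ⊆ acc C := by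
  intro β hβ
  have hβδ : β < δ := (isClubIn_trim hp hC hδ).1 hβ.1
  obtain ⟨hmem, hlim⟩ := mem_acc.1 hβ
  have hlimC : IsLimPt C β := by
    by_cases hcof : ∀ a < δ, ∃ γ ∈ keptSet R C, a < γ
    · exact ((isLimPt_trim_iff hp hcof).1 hlim).mono keptSet_subset
    · rw [trim_of_not_cofinal hcof] at hlim
      exact hlim.mono fun t ht => ht.1
  exact mem_acc.2 ⟨(isClubIn_iff.1 hC).2.2 β hβδ hlimC, hlimC⟩

/-- If the kept elements are cofinal in δ, then β is a limit of them, so they are cofinal in β too.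
Otherwise β exceeds their supremum, and both sides cut the club at that same supremum. -/
theorem trim_inter_Iio (hp : ∀ s γ, R s γ → s < p s γ ∧ p s γ < γ) (hC : IsClubIn C δ)
    (hδ : IsSuccLimit δ) {β : Ordinal.{u}} (hβ : β ∈ acc (trim R p C δ)) :
    trim R p (C ∩ Iio β) β = trim R p C δ ∩ Iio β := by
  have hβδ : β < δ := (isClubIn_trim hp hC hδ).1 hβ.1
  obtain ⟨hmem, hlim⟩ := mem_acc.1 hβ
  have hK := keptSet_inter_Iio R C β
  by_cases hcof : ∀ a < δ, ∃ γ ∈ keptSet R C, a < γ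
  · rw [isLimPt_trim_iff hp hcof] at hlim
    have hcof' : ∀ a < β, ∃ γ ∈ keptSet R (C ∩ Iio β), a < γ := fun a ha => by
      obtain ⟨c, hc, hac, hcβ⟩ := hlim.2 a ha
      exact ⟨c, hK ▸ ⟨hc, hcβ⟩, hac⟩
    have hsub : ∀ γ < β, substPoint R p (C ∩ Iio β) γ = substPoint R p C γ := fun γ hγ => by
      have : keptSet R C ∩ Iio β ∩ Iio γ = keptSet R C ∩ Iio γ := by
        rw [inter_assoc, Iio_inter_Iio, min_eq_right hγ.le]
      rw [substPoint, substPoint, hK, this]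
    rw [trim_of_cofinal hcof, trim_of_cofinal hcof', hK]
    ext t
    simp only [mem_union, mem_image, mem_inter_iff, mem_ofPred_eq, mem_Iio]
    constructor
    · rintro (⟨γ, ⟨hγ, hγβ⟩, rfl⟩ | ⟨htβ, h⟩)
      · rw [hsub γ hγβ]
        exact ⟨Or.inl ⟨γ, hγ, rfl⟩, (subst_lt hp hγ).trans hγβ⟩
      · exact ⟨Or.inr ⟨htβ.trans hβδ, (isLimPt_inter_Iio htβ.le).1 h⟩, htβ⟩
    · rintro ⟨⟨γ, hγ, rfl⟩ | ⟨htδ, h⟩, htβ⟩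
      · have hγβ : γ < β := by
          by_contra! hle
          exact (lt_subst_of_isLimPt hp hγ hlim hle).not_gt htβ
        exact Or.inl ⟨γ, ⟨hγ, hγβ⟩, hsub γ hγβ⟩
      · exact Or.inr ⟨htβ, (isLimPt_inter_Iio htβ.le).2 h⟩
  · rw [trim_of_not_cofinal hcof] at hmem
    have hbdd : BddAbove (keptSet R C) := ⟨δ, fun k hk => (hC.1 (keptSet_subset hk)).le⟩
    have hKβ : keptSet R C ∩ Iio β = keptSet R C :=
      inter_eq_left.2 fun k hk => (le_csSup hbdd hk).trans_lt hmem.2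
    rw [hKβ] at hK
    have hcof' : ¬ ∀ a < β, ∃ γ ∈ keptSet R (C ∩ Iio β), a < γ := fun h => by
      obtain ⟨γ, hγ, hlt⟩ := h _ hmem.2
      exact (le_csSup hbdd (hK ▸ hγ)).not_gt hlt
    rw [trim_of_not_cofinal hcof, trim_of_not_cofinal hcof', hK]
    ext t
    simp only [mem_ofPred_eq, mem_inter_iff, mem_Iio]
    tauto

theorem nacc_trim_subset (hp : ∀ s γ, R s γ → s < p s γ ∧ p s γ < γ)
    (hR : ∀ s < δ, ∃ γ ∈ C, R s γ) :
    nacc (trim R p C δ) ⊆ {t | ∃ s, ∃ γ ∈ C, R s γ ∧ t = p s γ} := by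
  have hcof : ∀ a < δ, ∃ γ ∈ keptSet R C, a < γ := by
    by_contra hcof
    push Not at hcof
    obtain ⟨b, hb, hbK⟩ := hcof
    -- If the kept elements were bounded, a γ related to their supremum would itself be kept,
    -- although it lies above that supremum.
    obtain ⟨γ, hγ, hRγ⟩ := hR (sSup (keptSet R C)) ((csSup_le' fun k hk => hbK k hk).trans_lt hb)
    have hlt : sSup (keptSet R C) < γ := (hp _ _ hRγ).1.trans (hp _ _ hRγ).2
    have hbdd : BddAbove (keptSet R C) := ⟨b, hbK⟩
    have hKγ : keptSet R C ∩ Iio γ = keptSet R C :=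
      inter_eq_left.2 fun k hk => (le_csSup hbdd hk).trans_lt hlt
    have hmem : γ ∈ keptSet R C := mem_keptSet.2 ⟨hγ, by rwa [hKγ]⟩
    exact (le_csSup hbdd hmem).not_gt hlt
  rintro t ⟨ht, htacc⟩
  have ht2 := ht
  rw [trim_of_cofinal hcof] at ht2
  rcases ht2 with ⟨γ, hγ, rfl⟩ | ⟨-, hlim⟩
  · exact ⟨_, γ, keptSet_subset hγ, (mem_keptSet.1 hγ).2, rfl⟩
  · exact absurd (mem_acc.2 ⟨ht, (isLimPt_trim_iff hp hcof).2 hlim⟩) htacc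

end trim

/-! ### Trimming and cutting square sequences. -/

open Classical in
/-- Apply `trim` at every limit ordinal. -/
noncomputable def trimSeq (R : Ordinal.{u} → Ordinal.{u} → Prop)
    (p : Ordinal.{u} → Ordinal.{u} → Ordinal.{u}) (C : Ordinal.{u} → Set Ordinal.{u})
    (α : Ordinal.{u}) : Set Ordinal.{u} :=
  if IsSuccLimit α then trim R p (C α) α else ∅

theorem isSuccLimit_of_mem_acc {C : Set Ordinal.{u}} {β : Ordinal.{u}} (h : β ∈ acc C) :
    IsSuccLimit β :=
  (mem_acc.1 h).2.isSuccLimit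

theorem isSquareSeq_trimSeq {μ : Cardinal.{u}} {R : Ordinal.{u} → Ordinal.{u} → Prop}
    {p : Ordinal.{u} → Ordinal.{u} → Ordinal.{u}} {C : Ordinal.{u} → Set Ordinal.{u}}
    (hp : ∀ s γ, R s γ → s < p s γ ∧ p s γ < γ) (hC : IsSquareSeq μ C) :
    IsSquareSeq μ (trimSeq R p C) := by
  intro α hα hlim
  obtain ⟨h1, h2, h3⟩ := hC α hα hlim
  simp only [trimSeq, if_pos hlim]
  refine ⟨isClubIn_trim hp h1 hlim, (otp_trim_le hp h1).trans h2, fun β hβ => ?_⟩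
  rw [if_pos (isSuccLimit_of_mem_acc hβ), h3 β (acc_trim_subset hp h1 hlim hβ),
    trim_inter_Iio hp h1 hlim hβ]

theorem acc_trimSeq_subset {μ : Cardinal.{u}} {R : Ordinal.{u} → Ordinal.{u} → Prop}
    {p : Ordinal.{u} → Ordinal.{u} → Ordinal.{u}} {C : Ordinal.{u} → Set Ordinal.{u}}
    (hp : ∀ s γ, R s γ → s < p s γ ∧ p s γ < γ) (hC : IsSquareSeq μ C) {α : Ordinal.{u}}
    (hα : α < succOrd μ) : acc (trimSeq R p C α) ⊆ acc (C α) := by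
  by_cases hlim : IsSuccLimit α
  · simp only [trimSeq, if_pos hlim]
    exact acc_trim_subset hp (hC α hα hlim).1 hlim
  · simp only [trimSeq, if_neg hlim]
    exact fun β hβ => hβ.1.elim

open Classical in
/-- Remove from `C α` everything up to the accumulation points that lie in `T`. -/
noncomputable def avoidSeq (T : Set Ordinal.{u}) (C : Ordinal.{u} → Set Ordinal.{u})
    (α : Ordinal.{u}) : Set Ordinal.{u} :=
  if IsSuccLimit α then {γ | γ ∈ C α ∧ ∀ β ∈ acc (C α), β ∈ T → β < γ} else ∅

theorem acc_avoidSeq {T : Set Ordinal.{u}} {C : Ordinal.{u} → Set Ordinal.{u}}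
    {α β : Ordinal.{u}} (hβ : β ∈ acc (avoidSeq T C α)) : β ∈ acc (C α) ∧ β ∉ T := by
  by_cases hlim : IsSuccLimit α
  · simp only [avoidSeq, if_pos hlim] at hβ
    obtain ⟨hmem, hl⟩ := mem_acc.1 hβ
    have : β ∈ acc (C α) := mem_acc.2 ⟨hmem.1, hl.mono fun t ht => ht.1⟩
    exact ⟨this, fun hT => (hmem.2 β this hT).false⟩
  · simp only [avoidSeq, if_neg hlim] at hβ
    exact hβ.1.elim

/-- At most one accumulation point is cut at, so a final segment survives. A surviving accumulation
point β lies above it, so C β is cut at the same place. -/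
theorem isSquareSeq_avoidSeq {μ : Cardinal.{u}} {T : Set Ordinal.{u}}
    {C : Ordinal.{u} → Set Ordinal.{u}} (hC : IsSquareSeq μ C)
    (hT : ∀ α < succOrd μ, IsSuccLimit α → (acc (C α) ∩ T).Subsingleton) :
    IsSquareSeq μ (avoidSeq T C) := by
  intro α hα hlim
  obtain ⟨h1, h2, h3⟩ := hC α hα hlim
  obtain ⟨hCα, -, hcl⟩ := isClubIn_iff.1 h1
  have hdef : ∀ β, IsSuccLimit β →
      avoidSeq T C β = {γ | γ ∈ C β ∧ ∀ β' ∈ acc (C β), β' ∈ T → β' < γ} :=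
    fun β hβ => if_pos hβ
  refine ⟨?_, ?_, fun β hβ => ?_⟩
  · rw [hdef α hlim]
    refine isClubIn_iff.2 ⟨fun t ht => hCα ht.1, fun a ha => ?_, fun β hβ hl => ?_⟩
    · obtain ⟨b, hb, hbT⟩ : ∃ b < α, ∀ β ∈ acc (C α), β ∈ T → β ≤ b := by
        rcases (acc (C α) ∩ T).eq_empty_or_nonempty with h | ⟨b, hb⟩
        · exact ⟨a, ha, fun β h1 h2 => (h.subset ⟨h1, h2⟩).elim⟩
        · exact ⟨b, hCα hb.1.1, fun β h1 h2 => (hT α hα hlim ⟨h1, h2⟩ hb).le⟩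
      obtain ⟨c, hc, hlt⟩ := h1.exists_gt hlim (max_lt ha hb)
      exact ⟨c, ⟨hc, fun β h h' => (hbT β h h').trans_lt ((le_max_right a b).trans_lt hlt)⟩,
        (le_max_left a b).trans hlt.le⟩
    · obtain ⟨c, hc, -, hcβ⟩ := hl.2 0 (pos_iff_ne_zero.2 hl.1)
      exact ⟨hcl β hβ (hl.mono fun t ht => ht.1), fun β' h h' => (hc.2 β' h h').trans hcβ⟩
  · rw [hdef α hlim]
    exact (otp_mono fun t ht => ht.1).trans h2
  · have hβC := (acc_avoidSeq hβ).1
    have hβ1 := hβ.1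
    rw [hdef α hlim] at hβ1
    rw [hdef β (isSuccLimit_of_mem_acc hβ), hdef α hlim, h3 β hβC, acc_inter_Iio]
    ext t
    simp only [mem_ofPred_eq, mem_inter_iff, mem_Iio]
    constructor
    · rintro ⟨⟨h, h'⟩, h''⟩
      exact ⟨⟨h, fun β' hb hb' => h'' β' ⟨hb, hβ1.2 β' hb hb'⟩ hb'⟩, h'⟩
    · rintro ⟨⟨h, h''⟩, h'⟩
      exact ⟨⟨h, h'⟩, fun β' hb hb' => h'' β' hb.1 hb'⟩

theorem avoidSeq_eq {T : Set Ordinal.{u}} {C : Ordinal.{u} → Set Ordinal.{u}} {α : Ordinal.{u}}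
    (hα : IsSuccLimit α) (h : ∀ β ∈ acc (C α), β ∉ T) : avoidSeq T C α = C α := by
  simp only [avoidSeq, if_pos hα]
  ext t
  exact ⟨fun ht => ht.1, fun ht => ⟨ht, fun β hβ hβT => absurd hβT (h β hβ)⟩⟩

/-! ### The diagonal construction. -/

/-- It suffices to guess cofinal sets at the non-accumulation points. -/
theorem clubSquare_of_nacc {μ : Cardinal.{u}} (hμ : ℵ₀ ≤ μ) {S S' : Set Ordinal.{u}}
    {C : Ordinal.{u} → Set Ordinal.{u}} (hC : IsSquareSeq μ C) (hS : S' ⊆ S)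
    (hguess : ∀ A, IsCofinalIn A (succOrd μ) →
      ∃ α ∈ S', α < succOrd μ ∧ IsSuccLimit α ∧ nacc (C α) ⊆ A)
    (hacc : ∀ α < succOrd μ, S' ∩ acc (C α) = ∅) : ClubSquare μ S := by
  refine ⟨C, S', hC, hS, fun D A hD hA => ?_, hacc⟩
  obtain ⟨hDκ, -, hDcl⟩ := isClubIn_iff.1 hD
  obtain ⟨hAκ, hAcof⟩ := isCofinalIn_iff.1 hA
  have hκ := isSuccLimit_succOrd hμ
  -- Thin `A` to those elements that `D` separates from all smaller elements of `A`; the least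
  -- element of `A` above a point of `D` is one.
  obtain ⟨α, hαS, hα, hlim, hn⟩ := hguess
      {a ∈ A | ∃ d ∈ D, d < a ∧ ∀ a' ∈ A, a' < a → a' ≤ d} <| by
    refine isCofinalIn_iff.2 ⟨fun a ha => hAκ ha.1, fun b hb => ?_⟩
    obtain ⟨d, hd, hbd⟩ := hD.exists_gt hκ hb
    have hne : {a | a ∈ A ∧ d < a}.Nonempty := by
      obtain ⟨a, ha, hda⟩ := hAcof _ (hκ.succ_lt (hDκ hd))
      exact ⟨a, ha, (lt_succ d).trans_le hda⟩
    obtain ⟨h1, h2⟩ := csInf_mem hne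
    refine ⟨_, ⟨h1, d, hd, h2, fun a' ha' hlt => ?_⟩, hbd.le.trans h2.le⟩
    by_contra! hda'
    exact (csInf_le' (show a' ∈ {a | a ∈ A ∧ d < a} from ⟨ha', hda'⟩)).not_gt hlt
  refine ⟨α, hαS, hα, hlim, fun β hβ => ?_, fun t ht => (hn ht).1⟩
  have hlimβ := (mem_acc.1 hβ).2
  -- The least point of C α above `c` has no point of C α between `c` and itself, so it is not an
  -- accumulation point.
  have hnext : ∀ a < β, ∃ t ∈ nacc (C α), a < t ∧ t < β := fun a ha => by
    obtain ⟨c, hc, hac, hcβ⟩ := hlimβ.2 a ha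
    obtain ⟨c', hc', hcc', hc'β⟩ := hlimβ.2 c hcβ
    have hne : {t | t ∈ C α ∧ c < t}.Nonempty := ⟨c', hc', hcc'⟩
    obtain ⟨h1, h2⟩ := csInf_mem hne
    refine ⟨_, ⟨h1, fun h => ?_⟩, hac.trans h2,
      (csInf_le' (show c' ∈ {t | t ∈ C α ∧ c < t} from ⟨hc', hcc'⟩)).trans_lt hc'β⟩
    obtain ⟨c₂, hc₂, hlt, hlt'⟩ := (mem_acc.1 h).2.2 c h2
    exact (csInf_le' (show c₂ ∈ {t | t ∈ C α ∧ c < t} from ⟨hc₂, hlt⟩)).not_gt hlt'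
  have hβα : β < α := (hC α hα hlim).1.1 hβ.1
  refine hDcl β (hβα.trans hα) ⟨hlimβ.1, fun a ha => ?_⟩
  obtain ⟨t, ht, hat, htβ⟩ := hnext a ha
  obtain ⟨t', ht', htt', ht'β⟩ := hnext t htβ
  -- The point `d` of `D` separating `t'` from smaller elements of `A` satisfies t ≤ d < t'.
  obtain ⟨-, d, hd, hdt', hle⟩ := hn ht'
  exact ⟨d, hd, hat.trans_le (hle t (hn ht).1 htt'), hdt'.trans ht'β⟩

/-- If `♣□_μ(S)` fails, then a recursion produces, for every way of reading guesses, cofinal sets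
`A ε` such that at each suitable `α ∈ T` some guess is correct before `ε` and wrong at `ε`. -/
theorem exists_diagonal_family {μ : Cardinal.{u}} (hμ : ℵ₀ ≤ μ) {S T : Set Ordinal.{u}}
    {C : Ordinal.{u} → Set Ordinal.{u}} (hC : IsSquareSeq μ C) (hTS : T ⊆ S)
    (hT : ∀ α < succOrd μ, IsSuccLimit α → (acc (C α) ∩ T).Subsingleton)
    (hS : ¬ ClubSquare μ S) (y : Ordinal.{u} → Iio μ.ord → Ordinal.{u})
    (e : Ordinal.{u} → Ordinal.{u} → Iio μ.ord) (j : Iio μ.ord) :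
    ∃ A : Iio μ.ord → Set Ordinal.{u}, (∀ ε, IsCofinalIn (A ε) (succOrd μ)) ∧
      ∀ α ∈ T, α < succOrd μ → IsSuccLimit α → (∀ β ∈ acc (C α), β ∉ T) →
        (∀ s < α, ∃ γ ∈ C α, ∃ β < γ, e β γ < j ∧ ∀ ε, y β ε ∈ A ε ∧ s < y β ε ∧ y β ε < γ) →
        ∀ ε, ∃ γ ∈ C α, ∃ β < γ, e β γ < j ∧ (∀ ε' < ε, y β ε' ∈ A ε') ∧ y β ε ∉ A ε := by
  have hbad : ∀ C' : Ordinal.{u} → Set Ordinal.{u}, ∃ A, IsCofinalIn A (succOrd μ) ∧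
      (IsSquareSeq μ C' → (∀ α < succOrd μ, T ∩ acc (C' α) = ∅) →
        ∀ α ∈ T, α < succOrd μ → IsSuccLimit α → ¬ nacc (C' α) ⊆ A) := by
    intro C'
    by_contra! hn
    -- Any cofinal set would do: it only serves to extract from `hn` the two facts that do not
    -- depend on `A`.
    have h0 : IsCofinalIn (Iio (succOrd μ)) (succOrd μ) :=
      isCofinalIn_iff.2 ⟨Subset.rfl, fun a ha => ⟨a, ha, le_rfl⟩⟩
    obtain ⟨h1, h2, -⟩ := hn _ h0
    exact hS (clubSquare_of_nacc hμ h1 hTS (fun A hA => (hn A hA).2.2) h2)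
  choose bad hbadcof hbad using hbad
  let good (ε : Iio μ.ord) (B : ∀ ε' < ε, Set Ordinal.{u}) (s γ β : Ordinal.{u}) : Prop :=
    β < γ ∧ e β γ < j ∧ (∀ ε' (h : ε' < ε), y β ε' ∈ B ε' h) ∧ s < y β ε ∧ y β ε < γ
  let R (ε : Iio μ.ord) (B : ∀ ε' < ε, Set Ordinal.{u}) (s γ : Ordinal.{u}) : Prop :=
    ∃ β, good ε B s γ β
  -- The chosen guess depends on `s` and `γ` but not on the club being trimmed, so replacements
  -- agree across the sequence.
  let p (ε : Iio μ.ord) (B : ∀ ε' < ε, Set Ordinal.{u}) (s γ : Ordinal.{u}) : Ordinal.{u} :=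
    y (Classical.epsilon (good ε B s γ)) ε
  have hgood : ∀ ε B s γ, R ε B s γ → good ε B s γ (Classical.epsilon (good ε B s γ)) :=
    fun ε B s γ h => Classical.epsilon_spec h
  let F (ε : Iio μ.ord) (B : ∀ ε' < ε, Set Ordinal.{u}) : Set Ordinal.{u} :=
    bad (trimSeq (R ε B) (p ε B) (avoidSeq T C))
  let A : Iio μ.ord → Set Ordinal.{u} := WellFoundedLT.fix F
  have hA : ∀ ε, A ε = F ε fun ε' _ => A ε' := fun ε => WellFoundedLT.fix_eq F ε
  refine ⟨A, fun ε => hA ε ▸ hbadcof _, fun α hαT hα hlim hacc hg ε => ?_⟩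
  set B : ∀ ε' < ε, Set Ordinal.{u} := fun ε' _ => A ε' with hB
  have hp : ∀ s γ, R ε B s γ → s < p ε B s γ ∧ p ε B s γ < γ :=
    fun s γ h => (hgood ε B s γ h).2.2.2
  have hsq := isSquareSeq_avoidSeq hC hT
  have hnot := hbad _ (isSquareSeq_trimSeq hp hsq) (fun α' hα' => by
    rw [eq_empty_iff_forall_notMem]
    rintro β ⟨hβT, hβ⟩
    exact (acc_avoidSeq (acc_trimSeq_subset hp hsq hα' hβ)).2 hβT) α hαT hα hlim
  change ¬ nacc _ ⊆ F ε B at hnot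
  rw [← hA ε, not_subset] at hnot
  obtain ⟨t, ht, htA⟩ := hnot
  simp only [trimSeq, if_pos hlim, avoidSeq_eq hlim hacc] at ht
  obtain ⟨s, γ, hγ, hR, rfl⟩ := nacc_trim_subset hp (fun s hs => by
    obtain ⟨γ, hγ, β, hβγ, hj, h⟩ := hg s hs
    exact ⟨γ, hγ, β, hβγ, hj, fun ε' _ => (h ε').1, (h ε).2⟩) ht
  obtain ⟨h1, h2, h3, -⟩ := hgood ε B s γ hR
  exact ⟨γ, hγ, _, h1, h2, h3, htA⟩

/-! ### The counting argument. -/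

/-- Some bounded supply of guesses at `C α` is correct cofinally often. -/
def GuessedAt {μ : Cardinal.{u}} {I : Type*} (x : Ordinal.{u} → I → Ordinal.{u})
    (e : Ordinal.{u} → Ordinal.{u} → Iio μ.ord) (A : I → Set Ordinal.{u})
    (C : Set Ordinal.{u}) (α : Ordinal.{u}) : Prop :=
  ∃ j, ∀ s < α, ∃ γ ∈ C, ∃ β < γ, e β γ < j ∧ ∀ i, x β i ∈ A i ∧ s < x β i ∧ x β i < γ

/-- The index (ρ, j, ε) records the order type of C α, the bound on the numbers of guesses, and the
stage of the recursion. All sets are built beforehand, so that the α supplied by `h` may select ρ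
and j afterwards. -/
theorem clubSquare_of_guessedAt {μ : Cardinal.{u}} (hμ : ℵ₀ ≤ μ) {S : Set Ordinal.{u}}
    {C : Ordinal.{u} → Set Ordinal.{u}} (hC : IsSquareSeq μ C)
    (x : Ordinal.{u} → Iio μ.ord × Iio μ.ord × Iio μ.ord → Ordinal.{u})
    (e : Ordinal.{u} → Ordinal.{u} → Iio μ.ord)
    (he : ∀ γ < succOrd μ, InjOn (fun β => e β γ) (Iio γ))
    (h : ∀ A : Iio μ.ord × Iio μ.ord × Iio μ.ord → Set Ordinal.{u},
      (∀ i, IsCofinalIn (A i) (succOrd μ)) → ∃ α ∈ S, α < succOrd μ ∧ IsSuccLimit α ∧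
        otp (C α) < Ordinal.lift.{u + 1} μ.ord ∧ GuessedAt x e A (C α) α) :
    ClubSquare μ S := by
  by_contra hS
  let T (ρ : Iio μ.ord) : Set Ordinal.{u} := {α ∈ S | otp (C α) = Ordinal.lift.{u + 1} ρ.1}
  have hotp : ∀ α < succOrd μ, IsSuccLimit α → ∀ β ∈ acc (C α), otp (C β) < otp (C α) :=
    fun α hα hlim β hβ => by
      rw [(hC α hα hlim).2.2 β hβ]
      exact otp_inter_Iio_lt hβ.1
  -- By coherence order types increase strictly along accumulation points, so at most one of them
  -- has type ρ.
  have hT : ∀ ρ, ∀ α < succOrd μ, IsSuccLimit α → (acc (C α) ∩ T ρ).Subsingleton := by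
    intro ρ α hα hlim
    have key : ∀ β ∈ acc (C α) ∩ T ρ, ∀ β' ∈ acc (C α) ∩ T ρ, ¬ β < β' := by
      rintro β ⟨hβ, hβT⟩ β' ⟨hβ', hβT'⟩ hlt
      have hmem : β ∈ acc (C β') := by
        rw [(hC α hα hlim).2.2 β' hβ', acc_inter_Iio]
        exact ⟨hβ, hlt⟩
      have := hotp β' (((hC α hα hlim).1.1 hβ'.1).trans hα) (isSuccLimit_of_mem_acc hβ') β hmem
      rw [hβT.2, hβT'.2] at this
      exact this.false
    exact fun β hβ β' hβ' => le_antisymm (not_lt.1 (key β' hβ' β hβ)) (not_lt.1 (key β hβ β' hβ'))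
  choose A hAcof hA using fun ρ j =>
    exists_diagonal_family hμ hC (fun α (h : α ∈ T ρ) => h.1) (hT ρ) hS
      (fun β ε => x β (ρ, j, ε)) e j
  obtain ⟨α, hαS, hα, hlim, hlt, j, hj⟩ := h (fun i => A i.1 i.2.1 i.2.2) fun i => hAcof _ _ _
  obtain ⟨ρ, hρ⟩ := mem_range_lift_of_le hlt.le
  have hρμ : ρ < μ.ord := by rwa [← hρ, Ordinal.lift_lt] at hlt
  have hαT : α ∈ T ⟨ρ, hρμ⟩ := ⟨hαS, hρ.symm⟩
  have hsep := hA ⟨ρ, hρμ⟩ j α hαT hα hlim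
    (fun β hβ hβT => by
      have := hotp α hα hlim β hβ
      rw [hβT.2, hαT.2] at this
      exact this.false)
    (fun s hs => by
      obtain ⟨γ, hγ, β, hβ, h1, h2⟩ := hj s hs
      exact ⟨γ, hγ, β, hβ, h1, fun ε => h2 (_, _, ε)⟩)
  choose γ hγ β hβγ hej hbefore hat using hsep
  have hinj : Function.Injective
      (fun ε => ((⟨γ ε, hγ ε⟩, ⟨e (β ε) (γ ε), hej ε⟩) : C α × Iio j)) := by
    -- The guess for the later stage is correct at ε, the guess for ε is not.
    have key : ∀ ε ε', ε < ε' → β ε ≠ β ε' := fun ε ε' hlt heq =>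
      hat ε (by rw [heq]; exact hbefore ε' ε hlt)
    intro ε ε' heq
    simp only [Prod.mk.injEq, Subtype.mk.injEq] at heq
    have hβ : β ε = β ε' := by
      refine he (γ ε) (((hC α hα hlim).1.1 (hγ ε)).trans hα) (hβγ ε)
        (show β ε' < γ ε by rw [heq.1]; exact hβγ ε') ?_
      change e (β ε) (γ ε) = e (β ε') (γ ε)
      rw [show e (β ε) (γ ε) = e (β ε') (γ ε') from congrArg Subtype.val heq.2, heq.1]
    rcases lt_trichotomy ε ε' with hlt | rfl | hlt
    · exact absurd hβ (key _ _ hlt)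
    · rfl
    · exact absurd hβ.symm (key _ _ hlt)
  have hcard := mk_le_of_injective hinj
  rw [Cardinal.mk_Iio_ordinal, card_ord, mk_prod, Cardinal.lift_id, Cardinal.lift_id] at hcard
  refine hcard.not_gt (mul_lt_of_lt ?_ (mk_lt_of_otp_lt hlt) ?_)
  · rwa [← Cardinal.lift_aleph0.{u + 1, u}, Cardinal.lift_le]
  · have : ord #(Iio μ.ord) = typeLT (Iio μ.ord) := by
      rw [Cardinal.mk_Iio_ordinal, card_ord, ← lift_ord]
      simp
    have h2 := mk_Iio_lt j this
    rwa [Cardinal.mk_Iio_ordinal, card_ord] at h2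

/-! ### Coding guesses and finding where they succeed. -/

theorem exists_enumeration {μ : Cardinal.{u}} (hμ : ℵ₀ ≤ μ)
    (hCH : (2 : Cardinal.{u}) ^ μ = succ μ) {I : Type (u + 1)}
    (hI : #I = Cardinal.lift.{u + 1} μ) :
    ∃ x : Ordinal.{u} → I → Ordinal.{u}, ∀ f : I → Ordinal.{u}, (∀ i, f i < succOrd μ) →
      ∃ β < succOrd μ, x β = f := by
  have hcard : #(Iio (succOrd μ)) = #(I → Iio (succOrd μ)) := by
    rw [← power_def, hI, Cardinal.mk_Iio_ordinal, succOrd, card_ord, ← Cardinal.lift_power, ← hCH,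
      ← power_mul, mul_eq_self hμ]
  obtain ⟨g⟩ := Cardinal.eq.1 hcard
  classical
  refine ⟨fun β i => if h : β < succOrd μ then (g ⟨β, h⟩ i).1 else 0, fun f hf => ?_⟩
  obtain ⟨β, hβ⟩ := g.surjective fun i => ⟨f i, hf i⟩
  refine ⟨β.1, β.2, ?_⟩
  ext i
  have : β.1 < succOrd μ := β.2
  simp [this, hβ]

theorem exists_injections {μ : Cardinal.{u}} (hμ : ℵ₀ ≤ μ) :
    ∃ e : Ordinal.{u} → Ordinal.{u} → Iio μ.ord,
      ∀ γ < succOrd μ, InjOn (fun β => e β γ) (Iio γ) := by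
  have hpos : (0 : Ordinal.{u}) < μ.ord := by
    rw [pos_iff_ne_zero, Ne, ord_eq_zero]
    exact (aleph0_pos.trans_le hμ).ne'
  have h : ∀ γ : Ordinal.{u}, ∃ g : Ordinal.{u} → Iio μ.ord, γ < succOrd μ → InjOn g (Iio γ) := by
    intro γ
    by_cases hγ : γ < succOrd μ
    · have hle : #(Iio γ) ≤ #(Iio μ.ord) := by
        rw [Cardinal.mk_Iio_ordinal, Cardinal.mk_Iio_ordinal, card_ord, Cardinal.lift_le]
        exact lt_succ_iff.1 (lt_ord.1 hγ)
      obtain ⟨g⟩ := hle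
      classical
      refine ⟨fun β => if h : β < γ then g ⟨β, h⟩ else ⟨0, hpos⟩, fun _ β hβ β' hβ' heq => ?_⟩
      have h1 : β < γ := hβ
      have h2 : β' < γ := hβ'
      simp only [h1, h2, dite_true] at heq
      exact congrArg Subtype.val (g.injective heq)
    · exact ⟨fun _ => ⟨0, hpos⟩, fun h => absurd h hγ⟩
  choose g hg using h
  exact ⟨fun β γ => g γ β, fun γ hγ => hg γ hγ⟩

/-- `b` is large enough to code a guess for the sets `A i` above `a`. -/
def Codes {I : Type*} (x : Ordinal.{u} → I → Ordinal.{u}) (A : I → Set Ordinal.{u})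
    (a b : Ordinal.{u}) : Prop :=
  a < b ∧ ∃ β < b, ∀ i, x β i ∈ A i ∧ a < x β i ∧ x β i < b

theorem Codes.anti {I : Type*} {x : Ordinal.{u} → I → Ordinal.{u}} {A : I → Set Ordinal.{u}}
    (a a' b : Ordinal.{u}) (h : a' ≤ a) (H : Codes x A a b) : Codes x A a' b := by
  obtain ⟨h1, β, h2, h3⟩ := H
  exact ⟨h.trans_lt h1, β, h2, fun i => ⟨(h3 i).1, h.trans_lt (h3 i).2.1, (h3 i).2.2⟩⟩

/-- Pick an element of each `A i` above `a`. These μ many values are bounded below μ⁺ by regularity,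
and some β lists them as `x β`. -/
theorem exists_codes {μ : Cardinal.{u}} (hμ : ℵ₀ ≤ μ) {I : Type (u + 1)}
    (hI : #I = Cardinal.lift.{u + 1} μ) {x : Ordinal.{u} → I → Ordinal.{u}}
    (hx : ∀ f : I → Ordinal.{u}, (∀ i, f i < succOrd μ) → ∃ β < succOrd μ, x β = f)
    {A : I → Set Ordinal.{u}} (hA : ∀ i, IsCofinalIn (A i) (succOrd μ)) (a : Ordinal.{u})
    (ha : a < succOrd μ) : ∃ b < succOrd μ, Codes x A a b := by
  have hκ := isSuccLimit_succOrd hμ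
  choose f hfA hf using fun i => (isCofinalIn_iff.1 (hA i)).2 _ (hκ.succ_lt ha)
  have hfκ : ∀ i, f i < succOrd μ := fun i => (isCofinalIn_iff.1 (hA i)).1 (hfA i)
  obtain ⟨β, hβ, rfl⟩ := hx f hfκ
  have hcard : #(range (x β)) < (Ordinal.lift.{u + 1} (succOrd μ)).cof := by
    rw [← lift_cof, cof_succOrd hμ]
    refine mk_range_le.trans_lt ?_
    rw [hI, Cardinal.lift_lt]
    exact lt_succ μ
  have hsup : sSup (range (x β)) < succOrd μ :=
    sSup_lt_of_lt_cof hcard (by rintro _ ⟨i, rfl⟩; exact hfκ i)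
  refine ⟨succ (max a (max β (sSup (range (x β))))),
    hκ.succ_lt (max_lt ha (max_lt hβ hsup)), lt_succ_of_le (le_max_left _ _), β,
    lt_succ_of_le ((le_max_left _ _).trans (le_max_right _ _)), fun i => ⟨hfA i, ?_, ?_⟩⟩
  · exact (lt_succ a).trans_le (hf i)
  · refine lt_succ_of_le (le_trans ?_ ((le_max_right _ _).trans (le_max_right _ _)))
    exact le_csSup ⟨succOrd μ, by rintro _ ⟨i, rfl⟩; exact (hfκ i).le⟩ ⟨i, rfl⟩

/-- Assign to each a < α the number of a correct guess lying above `a`. This maps α to μ, and since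
their cofinalities differ it is bounded on a cofinal set. -/
theorem guessedAt_of_cof_ne {μ : Cardinal.{u}} (hμ : ℵ₀ ≤ μ) {I : Type*}
    {x : Ordinal.{u} → I → Ordinal.{u}} {e : Ordinal.{u} → Ordinal.{u} → Iio μ.ord}
    {A : I → Set Ordinal.{u}} {C : Set Ordinal.{u}} {α : Ordinal.{u}} (hC : IsClubIn C α)
    (hα : ∀ a < α, ∃ b < α, Codes x A a b) (hcof : α.cof ≠ μ.ord.cof) :
    GuessedAt x e A C α := by
  have hex : ∀ a : Iio α, ∃ j, ∃ γ ∈ C, ∃ β < γ, e β γ = j ∧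
      ∀ i, x β i ∈ A i ∧ a.1 < x β i ∧ x β i < γ := fun a => by
    obtain ⟨b, hb, -, β, hβ, h⟩ := hα a a.2
    obtain ⟨γ, hγ, hbγ⟩ := (isClubIn_iff.1 hC).2.1 b hb
    exact ⟨_, γ, hγ, β, hβ.trans_le hbγ, rfl,
      fun i => ⟨(h i).1, (h i).2.1, (h i).2.2.trans_le hbγ⟩⟩
  choose f hf using hex
  have hlim : IsSuccLimit μ.ord := isSuccLimit_ord hμ
  have : NoMaxOrder (Iio μ.ord) :=
    ⟨fun a => ⟨⟨succ a.1, hlim.succ_lt a.2⟩, show a.1 < succ a.1 from lt_succ _⟩⟩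
  obtain ⟨j, hj⟩ := exists_isCofinal_setOf_lt f (by
    rw [cof_Iio_eq, cof_Iio_eq, Ne, Cardinal.lift_inj]
    exact hcof)
  refine ⟨j, fun s hs => ?_⟩
  obtain ⟨a, haj, hsa⟩ := hj ⟨s, hs⟩
  obtain ⟨γ, hγ, β, hβ, he, h⟩ := hf a
  exact ⟨γ, hγ, β, hβ, he ▸ haj, fun i => ⟨(h i).1, lt_of_le_of_lt hsa (h i).2.1, (h i).2.2⟩⟩

/-- A point of uncountable cofinality at which `S` reflects yields an element of `S` at which the
guesses work. -/
theorem exists_guessedAt_of_reflects {μ : Cardinal.{u}} (hμ : ℵ₀ ≤ μ) {I : Type*} [Nonempty I]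
    {x : Ordinal.{u} → I → Ordinal.{u}} {e : Ordinal.{u} → Ordinal.{u} → Iio μ.ord}
    {A : I → Set Ordinal.{u}} {C : Ordinal.{u} → Set Ordinal.{u}} (hC : IsSquareSeq μ C)
    {S : Set Ordinal.{u}} {δ : Ordinal.{u}} (hδκ : δ < succOrd μ) (hδ : ℵ₀ < δ.cof)
    (hS : IsStationaryIn (S ∩ Iio δ) δ) (hcl : ∀ a < δ, ∃ b < δ, Codes x A a b) :
    ∃ α ∈ S, α < succOrd μ ∧ IsSuccLimit α ∧
      otp (C α) < Ordinal.lift.{u + 1} μ.ord ∧ GuessedAt x e A (C α) α := by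
  have hlim : IsSuccLimit δ := one_lt_cof_iff.1 (one_lt_aleph0.trans hδ)
  obtain ⟨h1, h2, h3⟩ := hC δ hδκ hlim
  by_cases hcof : δ.cof = μ.ord.cof
  -- Here δ itself is unusable, but on a club below δ cofinalities are smaller than cf μ.
  · obtain ⟨D, hD, hDcof⟩ := exists_isClubIn_cof_lt hδ
    obtain ⟨α, ⟨hαS, hαδ⟩, ⟨-, hα0, hα⟩, hαD⟩ := hS.exists_mem
      ((isClubIn_closurePoints hδ Codes.anti (fun a b (h : Codes x A a b) => h.1) hcl).inter hδ hD)
    have hαlim : IsSuccLimit α := isSuccLimit_of_closurePoint hα0 fun a ha => by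
      obtain ⟨b, hb, hab, -⟩ := hα a ha
      exact ⟨b, hb, hab⟩
    have hne : α.cof ≠ μ.ord.cof := hcof ▸ (hDcof α hαD).ne
    have hακ : α < succOrd μ := lt_trans hαδ hδκ
    obtain ⟨g1, g2, -⟩ := hC α hακ hαlim
    exact ⟨α, hαS, hακ, hαlim, otp_lt_of_cof_ne g1 g2 hne, guessedAt_of_cof_ne hμ g1 hα hne⟩
  -- Here δ has a bound `j`. At α ∈ S closed under this guessing, α is an accumulation point of C δ,
  -- so C α is an initial segment of C δ and the same `j` works.
  · obtain ⟨j, hj⟩ := guessedAt_of_cof_ne (e := e) hμ h1 hcl hcof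
    let P (s γ : Ordinal.{u}) : Prop :=
      γ ∈ C δ ∧ ∃ β < γ, e β γ < j ∧ ∀ i, x β i ∈ A i ∧ s < x β i ∧ x β i < γ
    have hP : ∀ s γ, P s γ → s < γ := fun s γ ⟨_, β, _, _, h⟩ =>
      have ⟨i⟩ := ‹Nonempty I›
      (h i).2.1.trans (h i).2.2
    obtain ⟨α, ⟨hαS, hαδ⟩, -, hα0, hα⟩ := hS.exists_mem
      (isClubIn_closurePoints hδ (P := P)
        (fun a a' b h ⟨hb, β, hβ, hj, H⟩ =>
          ⟨hb, β, hβ, hj, fun i => ⟨(H i).1, h.trans_lt (H i).2.1, (H i).2.2⟩⟩) hP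
        fun a ha => by
          obtain ⟨γ, hγ, H⟩ := hj a ha
          exact ⟨γ, h1.1 hγ, hγ, H⟩)
    have hlimpt : IsLimPt (C δ) α := ⟨hα0, fun a ha => by
      obtain ⟨γ, hγ, H⟩ := hα a ha
      exact ⟨γ, H.1, hP _ _ H, hγ⟩⟩
    have hacc : α ∈ acc (C δ) := mem_acc.2 ⟨(isClubIn_iff.1 h1).2.2 α hαδ hlimpt, hlimpt⟩
    refine ⟨α, hαS, lt_trans hαδ hδκ, hlimpt.isSuccLimit, ?_, j, fun s hs => ?_⟩
    · rw [h3 α hacc]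
      exact (otp_inter_Iio_lt hacc.1).trans_le h2
    · obtain ⟨γ, hγ, hγC, H⟩ := hα s hs
      rw [h3 α hacc]
      exact ⟨γ, ⟨hγC, hγ⟩, H⟩

theorem exists_closurePoint_mem {μ : Cardinal.{u}} (hμ : ℵ₀ ≤ μ) {I : Type (u + 1)}
    (hI : #I = Cardinal.lift.{u + 1} μ) {x : Ordinal.{u} → I → Ordinal.{u}}
    (hx : ∀ f : I → Ordinal.{u}, (∀ i, f i < succOrd μ) → ∃ β < succOrd μ, x β = f)
    {A : I → Set Ordinal.{u}} (hA : ∀ i, IsCofinalIn (A i) (succOrd μ)) {S : Set Ordinal.{u}}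
    (hS : IsStationaryIn S (succOrd μ)) :
    ∃ α ∈ S, α < succOrd μ ∧ IsSuccLimit α ∧ ∀ a < α, ∃ b < α, Codes x A a b := by
  have hκ : ℵ₀ < (succOrd μ).cof := by
    rw [cof_succOrd hμ]
    exact lt_succ_of_le hμ
  obtain ⟨α, hαS, hακ, hα0, hα⟩ := hS.exists_mem (isClubIn_closurePoints hκ Codes.anti
    (fun a b (h : Codes x A a b) => h.1) (exists_codes hμ hI hx hA))
  refine ⟨α, hαS, hακ, isSuccLimit_of_closurePoint hα0 fun a ha => ?_, hα⟩
  obtain ⟨b, hb, hab, -⟩ := hα a ha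
  exact ⟨b, hb, hab⟩

theorem mk_index {μ : Cardinal.{u}} (hμ : ℵ₀ ≤ μ) :
    #(Iio μ.ord × Iio μ.ord × Iio μ.ord) = Cardinal.lift.{u + 1} μ := by
  have : ℵ₀ ≤ Cardinal.lift.{u + 1} μ := by rwa [aleph0_le_lift]
  simp only [mk_prod, Cardinal.lift_id, Cardinal.mk_Iio_ordinal, card_ord, mul_eq_self this]

/-! ### The implications of the equivalence. -/

theorem clubSquare_of_subset_cofNe {μ : Cardinal.{u}} (hμ : ℵ₀ ≤ μ)
    (hCH : (2 : Cardinal.{u}) ^ μ = succ μ) (hsq : Square μ) {S : Set Ordinal.{u}}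
    (hcof : S ⊆ cofNe (succOrd μ) μ.ord.cof) (hS : IsStationaryIn S (succOrd μ)) :
    ClubSquare μ S := by
  obtain ⟨C, hC⟩ := hsq
  obtain ⟨x, hx⟩ := exists_enumeration hμ hCH (mk_index hμ)
  obtain ⟨e, he⟩ := exists_injections hμ
  refine clubSquare_of_guessedAt hμ hC x e he fun A hA => ?_
  obtain ⟨α, hαS, hακ, hlim, hα⟩ := exists_closurePoint_mem hμ (mk_index hμ) hx hA hS
  obtain ⟨h1, h2, -⟩ := hC α hακ hlim
  have hne := (hcof hαS).2
  exact ⟨α, hαS, hακ, hlim, otp_lt_of_cof_ne h1 h2 hne, guessedAt_of_cof_ne hμ h1 hα hne⟩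

theorem clubSquare_of_reflects {μ : Cardinal.{u}} (hμ : ℵ₀ ≤ μ)
    (hCH : (2 : Cardinal.{u}) ^ μ = succ μ) (hsq : Square μ) {S : Set Ordinal.{u}}
    (hS : ReflectsStationarilyOften S (succOrd μ)) : ClubSquare μ S := by
  obtain ⟨C, hC⟩ := hsq
  obtain ⟨x, hx⟩ := exists_enumeration hμ hCH (mk_index hμ)
  obtain ⟨e, he⟩ := exists_injections hμ
  refine clubSquare_of_guessedAt hμ hC x e he fun A hA => ?_
  obtain ⟨δ, ⟨-, hδcof, hδS⟩, hδκ, -, hδ⟩ :=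
    exists_closurePoint_mem hμ (mk_index hμ) hx hA hS.2
  have : Nonempty (Iio μ.ord × Iio μ.ord × Iio μ.ord) := by
    rw [← mk_ne_zero_iff, mk_index hμ, Ne, Cardinal.lift_eq_zero]
    exact (aleph0_pos.trans_le hμ).ne'
  exact exists_guessedAt_of_reflects hμ hC hδκ hδcof hδS hδ

theorem ClubSquare.square {μ : Cardinal.{u}} {S : Set Ordinal.{u}} (h : ClubSquare μ S) :
    Square μ :=
  let ⟨C, _, hC, _⟩ := h
  ⟨C, hC⟩

theorem isStationaryIn_cof_eq {μ θ : Cardinal.{u}} (hθ : θ.IsRegular) (hθμ : θ ≤ μ) :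
    IsStationaryIn {α | α < succOrd μ ∧ α.cof = θ} (succOrd μ) :=
  isStationaryIn_of_forall (fun _ h => h.1) fun D hD => by
    obtain ⟨α, hα, hcof⟩ := hD.exists_cof_eq hθ hθμ
    exact ⟨α, ⟨hD.1 hα, hcof⟩, hα⟩

/-- Cofinality ω works unless cf μ = ω; then cofinality ω₁ does, as ω₁ ≤ μ. -/
theorem exists_isStationaryIn_cofNe {μ : Cardinal.{u}} (hμ : ℵ₀ < μ) :
    ∃ S ⊆ cofNe (succOrd μ) μ.ord.cof, IsStationaryIn S (succOrd μ) := by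
  by_cases h : μ.ord.cof = ℵ₀
  · refine ⟨_, ?_, isStationaryIn_cof_eq isRegular_aleph_one (by
      rwa [← succ_aleph0, succ_le_iff])⟩
    rintro α ⟨hα, hcof⟩
    exact ⟨hα, by rw [hcof, h]; exact aleph0_lt_aleph_one.ne'⟩
  · refine ⟨_, ?_, isStationaryIn_cof_eq isRegular_aleph0 hμ.le⟩
    rintro α ⟨hα, hcof⟩
    exact ⟨hα, by rw [hcof]; exact Ne.symm h⟩

/-- The full set reflects at every point of cofinality ω₁, and such points are stationary because ω₁
≤ μ. -/
theorem reflectsStationarilyOften_Iio {μ : Cardinal.{u}} (hμ : ℵ₀ < μ) :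
    ReflectsStationarilyOften (Iio (succOrd μ)) (succOrd μ) := by
  refine ⟨Subset.rfl, isStationaryIn_of_forall (fun _ h => h.1) fun D hD => ?_⟩
  obtain ⟨α, hα, hcof⟩ := hD.exists_cof_eq isRegular_aleph_one (by
    rwa [← succ_aleph0, succ_le_iff])
  have hακ : α < succOrd μ := hD.1 hα
  have hα0 : 0 < α := by
    rw [← Ordinal.cof_pos, hcof]
    exact aleph0_pos.trans aleph0_lt_aleph_one
  refine ⟨α, ⟨hακ, hcof ▸ aleph0_lt_aleph_one, isStationaryIn_of_forall inter_subset_right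
    fun E hE => ?_⟩, hα⟩
  obtain ⟨c, hc, -⟩ := (isClubIn_iff.1 hE).2.1 0 hα0
  have hcα : c < α := hE.1 hc
  exact ⟨c, ⟨hcα.trans hακ, hcα⟩, hc⟩

end OstaszewskiSquare

theorem theoremA (μ : Cardinal.{u}) (hμ : Cardinal.aleph0 < μ)
    (hCH : (2 : Cardinal.{u}) ^ μ = Order.succ μ) :
    List.TFAE [
      OstaszewskiSquare.Square μ,
      ∀ S : Set Ordinal.{u},
        S ⊆ OstaszewskiSquare.cofNe (OstaszewskiSquare.succOrd μ) μ.ord.cof →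
        OstaszewskiSquare.IsStationaryIn S (OstaszewskiSquare.succOrd μ) →
        OstaszewskiSquare.ClubSquare μ S,
      ∀ S : Set Ordinal.{u},
        OstaszewskiSquare.ReflectsStationarilyOften S (OstaszewskiSquare.succOrd μ) →
        OstaszewskiSquare.ClubSquare μ S] := by
  tfae_have 1 → 2 := fun h S hS hst =>
    OstaszewskiSquare.clubSquare_of_subset_cofNe hμ.le hCH h hS hst
  tfae_have 1 → 3 := fun h S hS => OstaszewskiSquare.clubSquare_of_reflects hμ.le hCH h hS
  tfae_have 2 → 1 := fun h => by
    obtain ⟨S, hS, hst⟩ := OstaszewskiSquare.exists_isStationaryIn_cofNe hμ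
    exact (h S hS hst).square
  tfae_have 3 → 1 := fun h => (h _ (OstaszewskiSquare.reflectsStationarilyOften_Iio hμ)).square
  tfae_finish
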